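/- Let $\mathbb{K}$ be an algebraically closed field of characteristic $0$ and let $V$ be a finite-dimensional $\mathbb{K}$-vector space. Let $\mu\subset\lambda$ be partitions (i.e. $\mu_i\le\lambda_i$ for all $i$), with conjugate partitions $\mu',\lambda'$, and let $h=\lambda_1$ be the number of columns of the diagram of $\lambda$. Put $$\textstyle\bigwedge_{\lambda'}V:=\bigwedge^{\lambda'_1}V\otimes\dots\otimes\bigwedge^{\lambda'_h}V,\qquad \bigwedge_{\mu'}V^*:=\bigwedge^{\mu'_1}V^*\otimes\dots\otimes\bigwedge^{\mu'_h}V^*,\qquad \bigwedge_{\lambda'/\mu'}V:=\bigwedge^{\lambda'_1-\mu'_1}V\otimes\dots\otimes\bigwedge^{\lambda'_h-\mu'_h}V,$$ where $\mu'_j=0$ if $\mu$ has fewer than $j$ columns, and $\bigwedge^0=\mathbb{K}$. For a skew diagram $\lambda/\mu$ with $d$ boxes, number the boxes by $1,\dots,d$ from top to bottom, starting from the first column, and let $R,C\subset\mathfrak{S}_d$ be the subgroups of permutations which preserve the content of every row, respectively of every column. The Young symmetrizer is the endomorphism of $V^{\otimes d}$ (symmetrize along rows, then antisymmetrize along columns)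 $$c_{\lambda/\mu}(v_1\otimes\dots\otimes v_d)=\sum_{\tau\in C}\sum_{\sigma\in R}\operatorname{sign}(\tau)\,v_{\sigma(\tau(1))}\otimes\dots\otimes v_{\sigma(\tau(d))}.$$ The skew Schur module $\mathbb{S}_{\lambda/\mu}V$ is the image of $c_{\lambda/\mu}$. It is regarded as a subspace of $\bigwedge_{\lambda'/\mu'}V$ through the inclusion $\bigwedge_{\lambda'/\mu'}V\subset V^{\otimes d}$ given on each factor by $v_1\wedge\dots\wedge v_k\mapsto\sum_{\pi\in\mathfrak{S}_k}\operatorname{sign}(\pi)\,v_{\pi(1)}\otimes\dots\otimes v_{\pi(k)}$. For $\mu=\emptyset$ this gives the Schur module $\mathbb{S}_\lambda V\subset\bigwedge_{\lambda'}V$, and likewise $\mathbb{S}_\mu V^*\subset\bigwedge_{\mu'}V^*$. For $0\le q\le k$ the skew-symmetric apolarity action $\bigwedge^kV\otimes\bigwedge^qV^*\to\bigwedge^{k-q}V$ is the linear map $$(v_1\wedge\dots\wedge v_k)\otimes(\alpha_1\wedge\dots\wedge\alpha_q)\longmapsto\sum_{R\subset\{1,\dots,k\},\ |R|=q}\operatorname{sign}(R)\,\det\big(\alpha_i(v_j)\big)_{1\le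 i\le q,\ j\in R}\;v_{\overline R},$$ where $v_{\overline R}$ is the wedge product, in increasing order, of the $v_j$ with $j\notin R$, and $\operatorname{sign}(R)$ is the sign of the permutation that lists the elements of $R$ in increasing order and then those of its complement in increasing order. Let $\tilde\varphi:\bigwedge_{\lambda'}V\otimes\bigwedge_{\mu'}V^*\to\bigwedge_{\lambda'/\mu'}V$ be the tensor product over $j=1,\dots,h$ of the skew-symmetric apolarity actions $\bigwedge^{\lambda'_j}V\otimes\bigwedge^{\mu'_j}V^*\to\bigwedge^{\lambda'_j-\mu'_j}V$. The Schur apolarity action $\varphi:\mathbb{S}_\lambda V\otimes\mathbb{S}_\mu V^*\to\bigwedge_{\lambda'/\mu'}V$ is the restriction of $\tilde\varphi$. Then the image of $\varphi$ is contained in $\mathbb{S}_{\lambda/\mu}V$. -/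

import Mathlib

open scoped TensorProduct BigOperators

noncomputable section

namespace SchurApolarity

/-! ### Skew diagrams given by columns

A (skew) diagram with columns `0, …, m - 1` is described by the length `a j` of its column `j` and
by the number `b j` of the row in which this column starts (rows are counted from `0`).
The Young diagram of `lam` has `a j = lam.colLen j` and `b j = 0`; the skew diagram `lam / mu` has
`a j = lam.colLen j - mu.colLen j` and `b j = mu.colLen j`. Columns may be empty. -/

/-- The boxes of a diagram: `⟨j, i⟩` is the `i`-th box from the top in column `j`. Reading the boxes
column by column, from top to bottom, is the standard filling by `1, 2, …, d`, so tensors in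
`V ^ (⊗ d)` are indexed directly by the boxes. -/
abbrev Box {m : ℕ} (a : Fin m → ℕ) : Type := Σ j : Fin m, Fin (a j)

/-- The row that contains a box. -/
def Box.row {m : ℕ} {a : Fin m → ℕ} (b : Fin m → ℕ) (x : Box a) : ℕ := b x.1 + x.2

/-- The permutations of the boxes which fix the content of every row. -/
def rowPerms {m : ℕ} (a b : Fin m → ℕ) : Finset (Equiv.Perm (Box a)) :=
  Finset.univ.filter fun s => ∀ x, (s x).row b = x.row b

/-- The permutations of the boxes which fix the content of every column. -/
def colPerms {m : ℕ} (a : Fin m → ℕ) : Finset (Equiv.Perm (Box a)) :=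
  Finset.univ.filter fun t => ∀ x, (t x).1 = x.1

variable (K : Type*) [Field K] (V : Type*) [AddCommGroup V] [Module K V]

/-- The tensor power of `V` with one factor for every box. -/
abbrev BoxTensor {m : ℕ} (a : Fin m → ℕ) : Type _ := ⨂[K] _ : Box a, V

/-- The tensor product of exterior powers `⋀^(a 0) V ⊗ ⋯ ⊗ ⋀^(a (m - 1)) V`. -/
abbrev ExtTensor {m : ℕ} (a : Fin m → ℕ) : Type _ := ⨂[K] j : Fin m, ⋀[K]^(a j) V

/-- The Young symmetrizer: symmetrize along the rows, then antisymmetrize along the columns. -/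
def youngSymmetrizer {m : ℕ} (a b : Fin m → ℕ) : BoxTensor K V a →ₗ[K] BoxTensor K V a :=
  ∑ t ∈ colPerms a, ∑ s ∈ rowPerms a b,
    ((Equiv.Perm.sign t : ℤ) : K) •
      (PiTensorProduct.reindex K (fun _ : Box a => V) (s * t)⁻¹).toLinearMap

theorem youngSymmetrizer_tprod {m : ℕ} (a b : Fin m → ℕ) (v : Box a → V) :
    youngSymmetrizer K V a b (PiTensorProduct.tprod K v) =
      ∑ t ∈ colPerms a, ∑ s ∈ rowPerms a b,
        ((Equiv.Perm.sign t : ℤ) : K) • PiTensorProduct.tprod K fun x => v (s (t x)) := by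
  simp only [youngSymmetrizer, LinearMap.sum_apply]
  refine Finset.sum_congr rfl fun t _ => Finset.sum_congr rfl fun s _ => ?_
  rw [LinearMap.smul_apply, LinearEquiv.coe_coe, PiTensorProduct.reindex_tprod]
  rfl

/-- The canonical identification of a tensor power indexed by boxes with the tensor product,
over all columns, of the tensor powers indexed by the boxes of the column. -/
def groupColumns {m : ℕ} (a : Fin m → ℕ) :
    BoxTensor K V a →ₗ[K] ⨂[K] j : Fin m, ⨂[K]^(a j) V :=
  PiTensorProduct.lift
    ((PiTensorProduct.tprod K).compMultilinearMap fun j : Fin m =>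
      (PiTensorProduct.tprod K : MultilinearMap K (fun _ : Fin (a j) => V) _))

theorem groupColumns_tprod {m : ℕ} (a : Fin m → ℕ) (v : Box a → V) :
    groupColumns K V a (PiTensorProduct.tprod K v) =
      PiTensorProduct.tprod K fun j => PiTensorProduct.tprod K fun i => v ⟨j, i⟩ := by
  simp only [groupColumns, PiTensorProduct.lift.tprod]
  rfl

/-- The inclusion of a product of exterior powers into the tensor power: in each factor,
`v₁ ∧ ⋯ ∧ vₖ` goes to the alternating sum of `v_{π(1)} ⊗ ⋯ ⊗ v_{π(k)}` over all `π`. -/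
def extInclusion {m : ℕ} (a : Fin m → ℕ) :
    ExtTensor K V a →ₗ[K] ⨂[K] j : Fin m, ⨂[K]^(a j) V :=
  PiTensorProduct.map fun j => exteriorPower.toTensorPower K V (a j)

/-- The (skew) Schur module of a diagram, as a subspace of the product of exterior powers of its
columns: the image of the Young symmetrizer. -/
def schurOfShape {m : ℕ} (a b : Fin m → ℕ) : Submodule K (ExtTensor K V a) :=
  ((LinearMap.range (youngSymmetrizer K V a b)).map (groupColumns K V a)).comap
    (extInclusion K V a)

/-- In characteristic zero, the product of exterior powers is a subspace of the tensor power. -/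
theorem extInclusion_injective [CharZero K] {m : ℕ} (a : Fin m → ℕ) :
    Function.Injective (extInclusion K V a) := by
  let p : ∀ j, (⨂[K]^(a j) V) →ₗ[K] ⋀[K]^(a j) V := fun j =>
    PiTensorProduct.lift (exteriorPower.ιMulti K (a j) (M := V)).toMultilinearMap
  have hp : ∀ j, p j ∘ₗ exteriorPower.toTensorPower K V (a j) =
      ((a j).factorial : K) • LinearMap.id := by
    intro j
    ext v : 2
    simp only [LinearMap.compAlternatingMap_apply, LinearMap.comp_apply,
      exteriorPower.toTensorPower_apply_ιMulti, map_sum, LinearMap.smul_apply, LinearMap.id_apply,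
      Units.smul_def, map_zsmul, p, PiTensorProduct.lift.tprod, AlternatingMap.coe_multilinearMap]
    have : ∀ t : Equiv.Perm (Fin (a j)), ((Equiv.Perm.sign t : ℤˣ) : ℤ) •
        exteriorPower.ιMulti K (a j) (fun i => v (t i)) = exteriorPower.ιMulti K (a j) v := by
      intro t
      have h := AlternatingMap.map_perm (exteriorPower.ιMulti K (a j) (M := V)) v t
      rw [← Units.smul_def, Function.comp_def] at *
      rw [h, smul_smul, Int.units_mul_self, one_smul]
    simp [this, Fintype.card_perm, Nat.cast_smul_eq_nsmul]
  have hc : PiTensorProduct.map p ∘ₗ extInclusion K V a =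
      (∏ j, ((a j).factorial : K)) • LinearMap.id := by
    rw [extInclusion, ← PiTensorProduct.map_comp]
    ext x
    simp [hp, MultilinearMap.map_smul_univ]
  have hne : (∏ j, ((a j).factorial : K)) ≠ 0 :=
    Finset.prod_ne_zero_iff.2 fun j _ => Nat.cast_ne_zero.2 (Nat.factorial_ne_zero _)
  intro x y hxy
  have := congrArg (PiTensorProduct.map p) hxy
  simp only [← LinearMap.comp_apply, hc] at this
  simpa [hne] using this

theorem sign_sigmaCongrRight {m : ℕ} {a : Fin m → ℕ} (F : ∀ j, Equiv.Perm (Fin (a j))) :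
    Equiv.Perm.sign (Equiv.Perm.sigmaCongrRight F) = ∏ j, Equiv.Perm.sign (F j) := by
  classical
  let f : (∀ j, Equiv.Perm (Fin (a j))) →* ℤˣ :=
    Equiv.Perm.sign.comp (Equiv.Perm.sigmaCongrRightHom fun j => Fin (a j))
  let g : (∀ j, Equiv.Perm (Fin (a j))) →* ℤˣ :=
    { toFun := fun F => ∏ j, Equiv.Perm.sign (F j)
      map_one' := by simp
      map_mul' := by simp [Finset.prod_mul_distrib] }
  have key : ∀ (j) (t : Equiv.Perm (Fin (a j))), f (Pi.mulSingle j t) = g (Pi.mulSingle j t) := by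
    intro j t
    induction t using Equiv.Perm.swap_induction_on with
    | one => simp
    | swap_mul t x y hxy ih =>
      rw [Pi.mulSingle_mul, map_mul, map_mul, ih]
      congr 1
      have h1 : Equiv.Perm.sigmaCongrRight (Pi.mulSingle j (Equiv.swap x y)) =
          Equiv.swap (⟨j, x⟩ : Σ j, Fin (a j)) ⟨j, y⟩ := by
        ext ⟨i, z⟩ : 1
        by_cases hij : i = j
        · subst hij
          simp [Equiv.swap_apply_def]
          split_ifs <;> rfl
        · rw [Equiv.swap_apply_of_ne_of_ne]
          · simp [Pi.mulSingle_eq_of_ne hij]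
          · rintro ⟨⟩; exact hij rfl
          · rintro ⟨⟩; exact hij rfl
      have h2 : f (Pi.mulSingle j (Equiv.swap x y)) = -1 := by
        change Equiv.Perm.sign (Equiv.Perm.sigmaCongrRight _) = _
        rw [h1, Equiv.Perm.sign_swap]
        simpa using hxy
      rw [h2]
      change _ = ∏ i, Equiv.Perm.sign ((Pi.mulSingle j (Equiv.swap x y) : ∀ j, Equiv.Perm (Fin (a j))) i)
      rw [Fintype.prod_eq_single (M := ℤˣ) j]
      · simp [Equiv.Perm.sign_swap hxy]
      · intro i hi; simp [Pi.mulSingle_eq_of_ne hi]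
  exact DFunLike.congr_fun (MonoidHom.pi_ext key : f = g) F

theorem map_range_youngSymmetrizer_le {m : ℕ} (a b : Fin m → ℕ) :
    (LinearMap.range (youngSymmetrizer K V a b)).map (groupColumns K V a) ≤
      LinearMap.range (extInclusion K V a) := by
  rw [← LinearMap.range_comp, LinearMap.range_eq_map, ← PiTensorProduct.span_tprod_eq_top,
    Submodule.map_span_le]
  rintro _ ⟨v, rfl⟩
  rw [LinearMap.comp_apply, youngSymmetrizer_tprod, Finset.sum_comm, map_sum]
  refine Submodule.sum_mem _ fun s _ => ⟨PiTensorProduct.tprod K fun j =>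
    exteriorPower.ιMulti K (a j) fun i => v (s ⟨j, i⟩), ?_⟩
  classical
  have hcol : colPerms a = Finset.univ.map
      ⟨Equiv.Perm.sigmaCongrRightHom fun j => Fin (a j),
        Equiv.Perm.sigmaCongrRightHom_injective⟩ := by
    ext t
    simp only [colPerms, Finset.mem_filter, Finset.mem_univ, true_and, Finset.mem_map,
      Function.Embedding.coeFn_mk]
    constructor
    · intro ht
      have hf : ∀ (j) (i : Fin (a j)), ∃ y : Fin (a j), t ⟨j, i⟩ = ⟨j, y⟩ := by
        intro j i
        have h := ht ⟨j, i⟩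
        rcases hx : t ⟨j, i⟩ with ⟨j', i'⟩
        rw [hx] at h
        subst h
        exact ⟨i', rfl⟩
      choose f hf using hf
      have hinj : ∀ j, Function.Injective (f j) := by
        intro j i i' h
        have : t ⟨j, i⟩ = t ⟨j, i'⟩ := by rw [hf, hf, h]
        simpa using this
      refine ⟨fun j => Equiv.ofBijective (f j) (Finite.injective_iff_bijective.1 (hinj j)), ?_⟩
      ext ⟨j, i⟩ : 1
      exact (hf j i).symm
    · rintro ⟨F, rfl⟩ x; rfl
  rw [hcol, Finset.sum_map, map_sum]
  simp only [extInclusion, PiTensorProduct.map_tprod, exteriorPower.toTensorPower_apply_ιMulti]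
  rw [MultilinearMap.map_sum]
  refine Finset.sum_congr rfl fun F _ => ?_
  simp only [Function.Embedding.coeFn_mk, map_smul, groupColumns_tprod,
    Equiv.Perm.sigmaCongrRightHom_apply, sign_sigmaCongrRight,
    Units.smul_def, ← Int.cast_smul_eq_zsmul K]
  rw [MultilinearMap.map_smul_univ]
  simp [Units.coe_prod]

/-- The inclusion of `⋀_{lam'} V` into the tensor power maps the Schur module onto the image of the
Young symmetrizer. -/
theorem map_schurOfShape {m : ℕ} (a b : Fin m → ℕ) :
    (schurOfShape K V a b).map (extInclusion K V a) =
      (LinearMap.range (youngSymmetrizer K V a b)).map (groupColumns K V a) :=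
  Submodule.map_comap_eq_of_le (map_range_youngSymmetrizer_le K V a b)

/-! ### Young diagrams and Schur modules -/

/-- The lengths of the first `m` columns of `lam`, i.e. the first `m` parts of the conjugate
partition (padded with zeros if `lam` has fewer columns; `⋀^0 V = K`). -/
def colLens (m : ℕ) (lam : YoungDiagram) : Fin m → ℕ := fun j => lam.colLen j

theorem colLens_mono (m : ℕ) {lam mu : YoungDiagram} (hmu : mu ≤ lam) (j : Fin m) :
    colLens m mu j ≤ colLens m lam j := by
  by_contra h
  exact lt_irrefl _ (YoungDiagram.mem_iff_lt_colLen.1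
    (hmu (YoungDiagram.mem_iff_lt_colLen.2 (not_le.1 h))))

/-- The lengths of the first `m` columns of the skew diagram `lam / mu`. -/
def skewColLens (m : ℕ) (lam mu : YoungDiagram) : Fin m → ℕ :=
  fun j => colLens m lam j - colLens m mu j

/-- The Schur module of `lam` (with at most `m` columns) inside `⋀_{lam'} V`. -/
def schurModule (m : ℕ) (lam : YoungDiagram) : Submodule K (ExtTensor K V (colLens m lam)) :=
  schurOfShape K V (colLens m lam) 0

/-- The skew Schur module of `lam / mu` (with at most `m` columns) inside `⋀_{lam' / mu'} V`. -/
def skewSchurModule (m : ℕ) (lam mu : YoungDiagram) :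
    Submodule K (ExtTensor K V (skewColLens m lam mu)) :=
  schurOfShape K V (skewColLens m lam mu) (colLens m mu)

/-! ### Apolarity actions -/

/-- The skew-symmetric apolarity action `⋀^h V* → ⋀^k V → ⋀^(k-h) V` for `h ≤ k`:
`α` sends `v₁ ∧ ⋯ ∧ vₖ` to the sum, over all ways to split `v₁, …, vₖ` into an ordered subset of
size `h` and its complement, of the sign of the splitting times the determinantal pairing of `α`
with the wedge of the first part, times the wedge of the second part. -/
def skewContraction {h k : ℕ} (hk : h ≤ k) :
    ⋀[K]^h (Module.Dual K V) →ₗ[K] ⋀[K]^k V →ₗ[K] ⋀[K]^(k - h) V :=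
  exteriorPower.alternatingMapLinearEquiv.toLinearMap ∘ₗ
    (AlternatingMap.domDomCongrₗ K
      (finSumFinEquiv.trans (finCongr (Nat.add_sub_of_le hk)))).toLinearMap ∘ₗ
    (LinearMap.compAlternatingMapₗ K (TensorProduct.lid K (⋀[K]^(k - h) V)).toLinearMap) ∘ₗ
    AlternatingMap.domCoprod' ∘ₗ
    (TensorProduct.mk K (V [⋀^Fin h]→ₗ[K] K) (V [⋀^Fin (k - h)]→ₗ[K] ⋀[K]^(k - h) V)).flip
      (exteriorPower.ιMulti K (k - h)) ∘ₗ
    exteriorPower.alternatingMapLinearEquiv.symm.toLinearMap ∘ₗ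
    exteriorPower.pairingDual K V h

/-- The equivalence `Fin h ⊕ Fin (k - h) ≃ Fin k` which lists the elements of `R` in increasing
order, followed by the elements of its complement in increasing order. -/
def splitEquiv {h k : ℕ} (R : {R : Finset (Fin k) // R.card = h}) :
    Fin h ⊕ Fin (k - h) ≃ Fin k :=
  finSumEquivOfFinset R.2 (by rw [Finset.card_compl, R.2, Fintype.card_fin])

theorem sum_modSumCongr {h k : ℕ} (e : Fin h ⊕ Fin (k - h) ≃ Fin k) {M : Type*} [AddCommMonoid M]
    (F : Equiv.Perm.ModSumCongr (Fin h) (Fin (k - h)) → M) :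
    ∑ s, F s = ∑ R : {R : Finset (Fin k) // R.card = h},
      F (Quotient.mk'' ((splitEquiv R).trans e.symm)) := by
  classical
  symm
  refine Fintype.sum_bijective (fun R : {R : Finset (Fin k) // R.card = h} =>
    (Quotient.mk'' ((splitEquiv R).trans e.symm) :
      Equiv.Perm.ModSumCongr (Fin h) (Fin (k - h)))) ⟨?_, ?_⟩ _ _ fun _ => rfl
  · intro R S hRS
    obtain ⟨⟨p, q⟩, hpq⟩ := QuotientGroup.leftRel_apply.mp (Quotient.exact' hRS)
    have key : ∀ x, splitEquiv S x = splitEquiv R (Equiv.Perm.sumCongrHom _ _ (p, q) x) := by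
      intro x
      rw [hpq]
      simp [Equiv.Perm.mul_apply, Equiv.Perm.inv_def]
    have hsub : S.1 ⊆ R.1 := by
      intro y hy
      obtain ⟨i, rfl⟩ : ∃ i, S.1.orderEmbOfFin S.2 i = y := by
        have : y ∈ Set.range (S.1.orderEmbOfFin S.2) := by simpa using hy
        exact this
      have := key (Sum.inl i)
      simp only [splitEquiv, finSumEquivOfFinset_inl, Equiv.Perm.sumCongrHom_apply,
        Equiv.Perm.sumCongr_apply, Sum.map_inl] at this
      rw [this]
      exact Finset.orderEmbOfFin_mem _ _ _
    exact Subtype.ext (Finset.eq_of_subset_of_card_le hsub (by rw [R.2, S.2])).symm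
  · intro s
    induction s using Quotient.inductionOn' with | _ s
    let R : Finset (Fin k) := Finset.univ.map ((Function.Embedding.inl.trans s.toEmbedding).trans
      e.toEmbedding)
    have hR : R.card = h := by simp [R]
    refine ⟨⟨R, hR⟩, ?_⟩
    apply Quotient.sound'
    rw [QuotientGroup.leftRel_apply]
    apply Equiv.Perm.mem_sumCongrHom_range_of_perm_mapsTo_inl
    rintro _ ⟨i, rfl⟩
    have hm : e (s (Sum.inl i)) ∈ R := by simp [R]
    obtain ⟨j, hj⟩ : ∃ j, R.orderEmbOfFin hR j = e (s (Sum.inl i)) := by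
      have : e (s (Sum.inl i)) ∈ Set.range (R.orderEmbOfFin hR) := by simpa using hm
      exact this
    refine ⟨j, ?_⟩
    rw [Equiv.Perm.mul_apply, Equiv.Perm.eq_inv_iff_eq]
    simp [splitEquiv, hj]

/-- The explicit formula for the skew-symmetric apolarity action. -/
theorem skewContraction_ιMulti {h k : ℕ} (hk : h ≤ k) (α : Fin h → Module.Dual K V)
    (v : Fin k → V) :
    skewContraction K V hk (exteriorPower.ιMulti K h α) (exteriorPower.ιMulti K k v) =
      ∑ R : {R : Finset (Fin k) // R.card = h},
        ((Equiv.Perm.sign ((splitEquiv R).trans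
          (finSumFinEquiv.trans (finCongr (Nat.add_sub_of_le hk))).symm) : ℤ) : K) •
        (Matrix.of fun i j : Fin h => α i (v (splitEquiv R (Sum.inl j)))).det •
        exteriorPower.ιMulti K (k - h) fun i => v (splitEquiv R (Sum.inr i)) := by
  simp only [skewContraction, LinearMap.comp_apply, LinearEquiv.coe_coe, LinearMap.flip_apply,
    TensorProduct.mk_apply, AlternatingMap.domCoprod'_apply,
    exteriorPower.alternatingMapLinearEquiv_apply_ιMulti, AlternatingMap.domDomCongrₗ_apply,
    LinearMap.compAlternatingMapₗ_apply, AlternatingMap.domDomCongr_apply,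
    LinearMap.compAlternatingMap_apply, AlternatingMap.domCoprod_apply, sum_apply]
  rw [map_sum, sum_modSumCongr (finSumFinEquiv.trans (finCongr (Nat.add_sub_of_le hk)))]
  refine Finset.sum_congr rfl fun R _ => ?_
  rw [AlternatingMap.domCoprod.summand_mk'', smul_apply,
    MultilinearMap.domDomCongr_apply, MultilinearMap.domCoprod_apply, Units.smul_def, map_zsmul,
    ← Int.cast_smul_eq_zsmul K, TensorProduct.lid_tmul]
  congr 2
  · simp [exteriorPower.alternatingMapLinearEquiv_symm_apply]
    rw [← Matrix.det_transpose]
    rfl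
  · simp

/-- The tensor product, over the columns, of skew-symmetric apolarity actions
`⋀_{lam'} V → ⋀_{mu'} V* → ⋀_{lam' / mu'} V`. -/
def extApolarity (m : ℕ) {lam mu : YoungDiagram} (hmu : mu ≤ lam) :
    ExtTensor K V (colLens m lam) →ₗ[K] ExtTensor K (Module.Dual K V) (colLens m mu) →ₗ[K]
      ExtTensor K V (skewColLens m lam mu) :=
  PiTensorProduct.map₂ fun j => (skewContraction K V (colLens_mono m hmu j)).flip

/-- The Schur apolarity action on `S_lam V ⊗ S_mu V*`, for `mu` contained in `lam`: the restriction
of the tensor product of the skew-symmetric apolarity actions. -/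
def schurApolarity (m : ℕ) {lam mu : YoungDiagram} (hmu : mu ≤ lam) :
    schurModule K V m lam ⊗[K] schurModule K (Module.Dual K V) m mu →ₗ[K]
      ExtTensor K V (skewColLens m lam mu) :=
  TensorProduct.lift (extApolarity K V m hmu) ∘ₗ
    TensorProduct.map (schurModule K V m lam).subtype
      (schurModule K (Module.Dual K V) m mu).subtype

end SchurApolarity

end

/-! In characteristic 0 the Schur module of any shape is spanned by flag tensors: one vector `x r`
is chosen for each row `r`, and each column contributes the wedge of the vectors of its rows. Row
symmetrizations are combinations of row-constant fillings by polarization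
(`sum_perm_eq_sum_fiberwise_const`), and conversely a row-constant filling is fixed by row
permutations. By bilinearity it suffices to contract the flag tensor of `x` with that of `α`.

If `α i (x j) = 0` for all `i < j` with `i` a row of `mu`, only one splitting survives in each
column: the first vectors are paired off, and the others remain in the same rows. The result is a
multiple of the skew flag tensor of the same `x` (`exists_skewContraction_eq_smul`). If instead the
leading minors of `α i (x l)` are nonzero, elimination reaches the triangular case by a
unitriangular change of `x`, under which the flag tensor is invariant.

In general, either the first column of `lam` carries dependent vectors and its wedge vanishes, or
`α` can be moved along a line `α + t β`, with `β` dual to `x`, on which the minors are nonzero for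
all but finitely many `t`. A polynomial argument recovers `t = 0`. -/

noncomputable section

namespace SchurApolarity

/-! ### Polarization, genericity and elimination -/

/-- Polarization: the sum of a multilinear map over all permutations of the variables which
preserve the fibres of `r` is an alternating sum of values at families constant on these fibres. -/
theorem sum_perm_eq_sum_fiberwise_const {R M N ι κ : Type*} [CommRing R] [AddCommMonoid M]
    [Module R M] [AddCommMonoid N] [Module R N] [Fintype ι] [DecidableEq ι] [DecidableEq κ]
    (F : MultilinearMap R (fun _ : ι => M) N) (r : ι → κ) (v : ι → M) :
    ∑ s : Equiv.Perm ι with ∀ x, r (s x) = r x, F (fun x => v (s x)) =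
      ∑ T : Finset ι, (-1 : R) ^ T.card • F fun y => ∑ z with z ∉ T ∧ r z = r y, v z := by
  -- Expanding in every slot leaves the fibre-preserving maps `g` whose image avoids `T`.
  have expand : ∀ T : Finset ι, F (fun y => ∑ z with z ∉ T ∧ r z = r y, v z) =
      ∑ g : ι → ι with ∀ y, r (g y) = r y,
        if T ⊆ (Finset.univ.image g)ᶜ then F (fun y => v (g y)) else 0 := by
    intro T
    rw [F.map_sum_finset (fun _ z => v z), ← Finset.sum_filter, Finset.filter_filter]
    refine Finset.sum_congr ?_ fun _ _ => rfl
    ext g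
    simp only [Fintype.mem_piFinset, Finset.mem_filter, Finset.mem_univ, true_and,
      Finset.subset_iff, Finset.mem_compl, Finset.mem_image, not_exists]
    constructor
    · intro h
      exact ⟨fun y => (h y).2, fun z hz y hy => (h y).1 (hy ▸ hz)⟩
    · intro h y
      exact ⟨fun hy => h.2 hy y rfl, h.1 y⟩
  -- Inclusion-exclusion: the signs over subsets of the complement of the image cancel unless that
  -- complement is empty.
  have coeff : ∀ g : ι → ι, (∑ T : Finset ι, (-1 : R) ^ T.card •
      if T ⊆ (Finset.univ.image g)ᶜ then F (fun y => v (g y)) else 0) =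
      if Function.Bijective g then F (fun y => v (g y)) else 0 := by
    intro g
    have h1 : (Finset.univ.image g)ᶜ = ∅ ↔ Function.Bijective g := by
      rw [Finset.compl_eq_empty_iff, ← Finite.surjective_iff_bijective, Finset.eq_univ_iff_forall]
      simp only [Finset.mem_image, Finset.mem_univ, true_and]
      rfl
    simp only [smul_ite, smul_zero]
    rw [← Finset.sum_filter, ← Finset.sum_smul]
    have h2 : (Finset.univ.filter fun T : Finset ι => T ⊆ (Finset.univ.image g)ᶜ) =
        ((Finset.univ.image g)ᶜ).powerset := by
      ext T; simp only [Finset.mem_filter, Finset.mem_univ, true_and, Finset.mem_powerset]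
    have h3 := congrArg (Int.cast : ℤ → R)
      (Finset.sum_powerset_neg_one_pow_card (x := (Finset.univ.image g)ᶜ))
    push_cast at h3
    rw [h2, h3]
    simp only [h1, ite_smul, one_smul, zero_smul]
  simp only [expand, Finset.smul_sum]
  rw [Finset.sum_comm]
  simp only [coeff]
  rw [← Finset.sum_filter, Finset.filter_filter]
  refine Finset.sum_bij (fun s _ => ⇑s) ?_ ?_ ?_ fun _ _ => rfl
  · intro s hs
    simpa [s.bijective] using hs
  · intro s _ t _ h
    exact DFunLike.coe_injective h
  · intro g hg
    simp only [Finset.mem_filter, Finset.mem_univ, true_and] at hg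
    exact ⟨Equiv.ofBijective g hg.2, by simpa using hg.1, rfl⟩

/-- If a line avoids finitely many of its points, its image under a multilinear map spans the
value at the base point. -/
theorem map_mem_of_map_add_smul_mem {K M N ι : Type*} [Field K] [Infinite K] [AddCommGroup M]
    [Module K M] [AddCommGroup N] [Module K N] [Fintype ι]
    (F : MultilinearMap K (fun _ : ι => M) N) (W : Submodule K N) (u w : ι → M) {s : Set K}
    (hs : s.Finite) (h : ∀ t ∉ s, F (fun i => u i + t • w i) ∈ W) : F u ∈ W := by
  classical
  rw [← Submodule.Quotient.mk_eq_zero W, ← Module.forall_dual_apply_eq_zero_iff K]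
  intro f
  -- Along the line, `f` modulo `W` is a polynomial in `t`; the set `S` records the slots filled
  -- from `w`.
  let p : Polynomial K := ∑ S : Finset ι,
    Polynomial.C (f (W.mkQ (F (S.piecewise w u)))) * Polynomial.X ^ S.card
  have hp : ∀ t, p.eval t = f (W.mkQ (F fun i => u i + t • w i)) := by
    intro t
    have h1 : (fun i => u i + t • w i) = (fun i => t • w i) + u := by
      ext i; simp [add_comm]
    have h2 : ∀ S : Finset ι, F (S.piecewise (fun i => t • w i) u) =
        t ^ S.card • F (S.piecewise w u) := by
      intro S
      have := F.map_piecewise_smul (fun _ => t) (S.piecewise w u) S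
      rw [Finset.prod_const] at this
      rw [← this]
      congr 1
      ext i
      by_cases hi : i ∈ S <;> simp [hi]
    rw [h1, F.map_add_univ]
    simp only [h2, map_sum, map_smul, p, Polynomial.eval_finsetSum, Polynomial.eval_mul,
      Polynomial.eval_C, Polynomial.eval_pow, Polynomial.eval_X, smul_eq_mul]
    exact Finset.sum_congr rfl fun S _ => mul_comm _ _
  have hp0 : p = 0 := by
    refine Polynomial.eq_zero_of_infinite_isRoot p (hs.infinite_compl.mono fun t ht => ?_)
    change p.eval t = 0
    rw [hp, Submodule.mkQ_apply, (Submodule.Quotient.mk_eq_zero W).2 (h t ht), map_zero]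
  have := hp 0
  simpa [hp0] using this.symm

/-- Alternating maps transform by the determinant under linear substitutions. -/
theorem alternatingMap_apply_matrix {R M N ι : Type*} [CommRing R] [AddCommGroup M]
    [Module R M] [AddCommGroup N] [Module R N] [Fintype ι] [DecidableEq ι]
    (f : M [⋀^ι]→ₗ[R] N) (A : Matrix ι ι R) (v : ι → M) :
    f (fun i => ∑ l, A i l • v l) = A.det • f v := by
  have h : f.compLinearMap (Fintype.linearCombination R v) =
      (LinearMap.toSpanSingleton R N (f v)).compAlternatingMap Matrix.detRowAlternating := by
    -- Both sides alternate in the rows of `A`, so permutations of the standard basis suffice.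
    refine Module.Basis.ext_alternating (Pi.basisFun R ι) fun σ hσ => ?_
    obtain ⟨s, rfl⟩ : ∃ s : Equiv.Perm ι, σ = s :=
      ⟨Equiv.ofBijective σ (Finite.injective_iff_bijective.1 hσ), rfl⟩
    have h1 : f.compLinearMap (Fintype.linearCombination R v) (Pi.basisFun R ι) = f v := by
      simp only [AlternatingMap.compLinearMap_apply]
      congr 1; ext i
      simp [Fintype.linearCombination_apply, Pi.single_apply]
    have h2 : (Matrix.detRowAlternating (R := R) : (ι → R) [⋀^ι]→ₗ[R] R) (Pi.basisFun R ι) = 1 := by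
      change Matrix.det (fun i => Pi.basisFun R ι i) = 1
      rw [← Matrix.det_one (n := ι) (R := R)]
      congr 1
      refine Matrix.ext fun i j => ?_
      simp [Matrix.one_apply, Pi.single_apply, eq_comm]
    have e1 := AlternatingMap.map_perm (f.compLinearMap (Fintype.linearCombination R v))
      (Pi.basisFun R ι) s
    have e2 := AlternatingMap.map_perm ((LinearMap.toSpanSingleton R N (f v)).compAlternatingMap
      Matrix.detRowAlternating) (Pi.basisFun R ι) s
    simp only [Function.comp_def] at e1 e2
    rw [e1, e2, h1]
    simp [h2]
  exact DFunLike.congr_fun h A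

/-- If the leading minors of `α i (x l)` do not vanish, a unitriangular change of the `x l` makes
the pairing lower triangular. -/
theorem exists_unitriangular {K V : Type*} [Field K] [AddCommGroup V] [Module K V]
    (α : ℕ → Module.Dual K V) (x : ℕ → V) (p : ℕ)
    (h : ∀ k ≤ p, (Matrix.of fun i l : Fin k => α i (x l)).det ≠ 0) :
    ∃ c : ℕ → ℕ → K, (∀ j, c j j = 1) ∧ (∀ j l, j < l → c j l = 0) ∧
      ∀ i j, i < p → i < j → α i (∑ l ∈ Finset.range (j + 1), c j l • x l) = 0 := by
  have key : ∀ j, ∃ d : ℕ → K, (∀ l, j ≤ l → d l = 0) ∧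
      ∀ i, i < p → i < j → α i (∑ l ∈ Finset.range j, d l • x l) = - α i (x j) := by
    intro j
    -- Exactly the equations with `i < min j p` are required, so a correction by the first `k`
    -- vectors gives a square system whose determinant is a leading minor.
    let k := min j p
    let A := Matrix.of fun i l : Fin k => α i (x l)
    let d := A⁻¹.mulVec fun i : Fin k => - α i (x j)
    have hd : A.mulVec d = fun i : Fin k => - α i (x j) := by
      rw [Matrix.mulVec_mulVec, Matrix.mul_nonsing_inv _ (h k (min_le_right _ _)).isUnit,
        Matrix.one_mulVec]
    refine ⟨fun l => if hl : l < k then d ⟨l, hl⟩ else 0, ?_, ?_⟩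
    · intro l hl
      exact dif_neg (by omega)
    · intro i hip hij
      have hik : i < k := by omega
      have h1 := congrFun hd ⟨i, hik⟩
      rw [← h1, map_sum]
      have h2 : Finset.range k ⊆ Finset.range j := Finset.range_subset_range.2 (min_le_left _ _)
      rw [← Finset.sum_subset h2]
      · rw [Finset.sum_range]
        simp [Matrix.mulVec, dotProduct, A, mul_comm]
      · intro l _ hl
        simp [show ¬ l < k by simpa using hl]
  choose d hd0 hd using key
  refine ⟨fun j l => if l = j then 1 else d j l, by simp, ?_, ?_⟩
  · intro j l hjl
    simp [hjl.ne', hd0 j l hjl.le]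
  · intro i j hi hij
    rw [Finset.sum_range_succ, map_add]
    have : ∑ l ∈ Finset.range j, (if l = j then 1 else d j l) • x l =
        ∑ l ∈ Finset.range j, d j l • x l :=
      Finset.sum_congr rfl fun l hl => by rw [if_neg (Finset.mem_range.1 hl).ne]
    rw [this, hd j i hi hij]
    simp

/-- Linearly independent vectors have dual functionals, and generic translates of given
functionals by multiples of these have nonvanishing leading minors. -/
theorem exists_translate_det_ne_zero {K V : Type*} [Field K] [AddCommGroup V] [Module K V]
    (α : ℕ → Module.Dual K V) (x : ℕ → V) (n : ℕ)
    (hx : LinearIndependent K fun i : Fin n => x i) :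
    ∃ (β : ℕ → Module.Dual K V) (s : Set K), s.Finite ∧ ∀ t ∉ s, ∀ k ≤ n,
      (Matrix.of fun i l : Fin k => (α i + t • β i) (x l)).det ≠ 0 := by
  obtain ⟨g, hg⟩ := LinearMap.exists_leftInverse_of_injective
    (Fintype.linearCombination K fun i : Fin n => x i)
    (LinearMap.ker_eq_bot.2 (linearIndependent_iff_injective_fintypeLinearCombination.1 hx))
  have hgx : ∀ i : Fin n, g (x i) = Pi.single i 1 := by
    intro i
    have := LinearMap.congr_fun hg (Pi.single i 1)
    simpa using this
  -- Since `β` is dual to `x`, the translated pairing matrix is `t • 1 - B k`; its determinant is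
  -- the characteristic polynomial of `B k` at `t`, which is monic.
  let B : ∀ k : ℕ, Matrix (Fin k) (Fin k) K := fun k => -Matrix.of fun i l : Fin k => α i (x l)
  refine ⟨fun i => if h : i < n then LinearMap.proj ⟨i, h⟩ ∘ₗ g else 0,
    ⋃ k ∈ Finset.range (n + 1), {t | (B k).charpoly.IsRoot t}, ?_, ?_⟩
  · exact Set.Finite.biUnion (Finset.finite_toSet _) fun k _ =>
      Polynomial.finite_setOfPred_isRoot (Matrix.charpoly_monic _).ne_zero
  · intro t ht k hk h0
    apply ht
    simp only [Set.mem_iUnion]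
    refine ⟨k, by simpa using Nat.lt_succ_of_le hk, ?_⟩
    change (B k).charpoly.eval t = 0
    rw [Matrix.eval_charpoly, ← h0]
    congr 1
    ext i l
    have hi : (i : ℕ) < n := i.2.trans_le hk
    have hl := hgx ⟨l, l.2.trans_le hk⟩
    simp only at hl
    simp [B, hi, hl, Matrix.scalar_apply, Matrix.diagonal_apply, Pi.single_apply, Fin.ext_iff,
      add_comm]

/-! ### Flag tensors span Schur modules -/

section Spanning

variable (K : Type*) [Field K] (V : Type*) [AddCommGroup V] [Module K V]

/-- The decomposable tensor in the product of exterior powers with a given vector in each box. -/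
def wedgeTensor {m : ℕ} (a : Fin m → ℕ) :
    MultilinearMap K (fun _ : Box a => V) (ExtTensor K V a) :=
  (PiTensorProduct.tprod K).compMultilinearMap fun j : Fin m =>
    (exteriorPower.ιMulti K (a j) (M := V)).toMultilinearMap

theorem wedgeTensor_apply {m : ℕ} (a : Fin m → ℕ) (v : Box a → V) :
    wedgeTensor K V a v =
      PiTensorProduct.tprod K fun j => exteriorPower.ιMulti K (a j) fun i => v ⟨j, i⟩ :=
  rfl

/-- The tensor `⨂ⱼ (x (b j) ∧ ⋯ ∧ x (b j + a j - 1))` with a vector for each row. -/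
def flagTensor {m : ℕ} (a b : Fin m → ℕ) (x : ℕ → V) : ExtTensor K V a :=
  wedgeTensor K V a fun y => x (y.row b)

theorem colPerms_eq_map {m : ℕ} (a : Fin m → ℕ) :
    colPerms a = Finset.univ.map
      ⟨Equiv.Perm.sigmaCongrRightHom fun j => Fin (a j),
        Equiv.Perm.sigmaCongrRightHom_injective⟩ := by
  ext t
  simp only [colPerms, Finset.mem_filter, Finset.mem_univ, true_and, Finset.mem_map,
    Function.Embedding.coeFn_mk]
  constructor
  · intro ht
    have hf : ∀ (j) (i : Fin (a j)), ∃ y : Fin (a j), t ⟨j, i⟩ = ⟨j, y⟩ := by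
      intro j i
      have h := ht ⟨j, i⟩
      rcases hx : t ⟨j, i⟩ with ⟨j', i'⟩
      rw [hx] at h
      subst h
      exact ⟨i', rfl⟩
    choose f hf using hf
    have hinj : ∀ j, Function.Injective (f j) := by
      intro j i i' h
      have : t ⟨j, i⟩ = t ⟨j, i'⟩ := by rw [hf, hf, h]
      simpa using this
    refine ⟨fun j => Equiv.ofBijective (f j) (Finite.injective_iff_bijective.1 (hinj j)), ?_⟩
    ext ⟨j, i⟩ : 1
    exact (hf j i).symm
  · rintro ⟨F, rfl⟩ x; rfl

/-- Antisymmetrization along the columns is the inclusion of the product of exterior powers. -/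
theorem groupColumns_alternating_sum {m : ℕ} (a : Fin m → ℕ) (v : Box a → V) :
    groupColumns K V a (∑ t ∈ colPerms a,
      ((Equiv.Perm.sign t : ℤ) : K) • PiTensorProduct.tprod K fun x => v (t x)) =
      extInclusion K V a (wedgeTensor K V a v) := by
  rw [colPerms_eq_map, Finset.sum_map, map_sum, wedgeTensor_apply]
  simp only [extInclusion, PiTensorProduct.map_tprod, exteriorPower.toTensorPower_apply_ιMulti]
  rw [MultilinearMap.map_sum]
  refine Finset.sum_congr rfl fun F _ => ?_
  simp only [Function.Embedding.coeFn_mk, map_smul, groupColumns_tprod,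
    Equiv.Perm.sigmaCongrRightHom_apply, sign_sigmaCongrRight,
    Units.smul_def, ← Int.cast_smul_eq_zsmul K]
  rw [MultilinearMap.map_smul_univ]
  simp [Units.coe_prod]

theorem groupColumns_youngSymmetrizer_tprod {m : ℕ} (a b : Fin m → ℕ) (v : Box a → V) :
    groupColumns K V a (youngSymmetrizer K V a b (PiTensorProduct.tprod K v)) =
      extInclusion K V a (∑ s ∈ rowPerms a b, wedgeTensor K V a fun x => v (s x)) := by
  rw [youngSymmetrizer_tprod, Finset.sum_comm, map_sum, map_sum]
  exact Finset.sum_congr rfl fun s _ => groupColumns_alternating_sum K V a fun x => v (s x)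

/-- Polarization along the fibres of the row function yields fillings constant on rows, which are
flag tensors. -/
theorem sum_rowPerms_wedgeTensor_mem_span {m : ℕ} (a b : Fin m → ℕ) (v : Box a → V) :
    ∑ s ∈ rowPerms a b, wedgeTensor K V a (fun x => v (s x)) ∈
      Submodule.span K (Set.range (flagTensor K V a b)) := by
  classical
  have h := sum_perm_eq_sum_fiberwise_const (wedgeTensor K V a) (fun x => x.row b) v
  have h' : ∑ s ∈ rowPerms a b, wedgeTensor K V a (fun x => v (s x)) = _ :=
    (Finset.sum_congr (by ext s; simp [rowPerms]) fun _ _ => rfl).trans h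
  rw [h']
  exact Submodule.sum_mem _ fun T _ => Submodule.smul_mem _ _
    (Submodule.subset_span ⟨fun r => ∑ z with z ∉ T ∧ z.row b = r, v z, rfl⟩)

theorem schurOfShape_le_span [CharZero K] {m : ℕ} (a b : Fin m → ℕ) :
    schurOfShape K V a b ≤ Submodule.span K (Set.range (flagTensor K V a b)) := by
  rw [← Submodule.map_le_map_iff_of_injective (extInclusion_injective K V a), map_schurOfShape,
    ← LinearMap.range_comp, LinearMap.range_eq_map, ← PiTensorProduct.span_tprod_eq_top,
    Submodule.map_span_le]
  rintro _ ⟨v, rfl⟩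
  exact ⟨_, sum_rowPerms_wedgeTensor_mem_span K V a b v,
    (groupColumns_youngSymmetrizer_tprod K V a b v).symm⟩

/-- Row symmetrization multiplies a row-constant filling by the order of the row group, which is
invertible in characteristic 0. -/
theorem flagTensor_mem_schurOfShape [CharZero K] {m : ℕ} (a b : Fin m → ℕ) (x : ℕ → V) :
    flagTensor K V a b x ∈ schurOfShape K V a b := by
  have hsum : ∑ s ∈ rowPerms a b, wedgeTensor K V a (fun y => x ((s y).row b)) =
      ((rowPerms a b).card : K) • flagTensor K V a b x := by
    rw [Nat.cast_smul_eq_nsmul, ← Finset.sum_const]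
    refine Finset.sum_congr rfl fun s hs => ?_
    rw [flagTensor]
    congr 1
    ext y
    rw [(Finset.mem_filter.1 hs).2 y]
  have hne : ((rowPerms a b).card : K) ≠ 0 :=
    Nat.cast_ne_zero.2 (Finset.card_ne_zero_of_mem (a := 1) (by simp [rowPerms]))
  rw [← Submodule.smul_mem_iff _ hne, ← hsum]
  exact ⟨_, ⟨_, rfl⟩, groupColumns_youngSymmetrizer_tprod K V a b fun y => x (y.row b)⟩

end Spanning

/-! ### Contraction of flag tensors -/

section Contraction

variable {K : Type*} [Field K] {V : Type*} [AddCommGroup V] [Module K V]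

/-- A flag tensor of a Young diagram depends only on the flag, up to unitriangular changes. -/
theorem flagTensor_unitriangular {m : ℕ} (a : Fin m → ℕ) (x : ℕ → V) (c : ℕ → ℕ → K)
    (hc1 : ∀ j, c j j = 1) (hc0 : ∀ j l, j < l → c j l = 0) :
    flagTensor K V a 0 (fun j => ∑ l ∈ Finset.range (j + 1), c j l • x l) =
      flagTensor K V a 0 x := by
  simp only [flagTensor, wedgeTensor_apply, Box.row, Pi.zero_apply, zero_add]
  congr 1
  ext1 j
  have h : (fun i : Fin (a j) => ∑ l ∈ Finset.range ((i : ℕ) + 1), c i l • x l) =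
      fun i => ∑ l : Fin (a j), Matrix.of (fun i l : Fin (a j) => c i l) i l • x l := by
    ext i
    simp only [Matrix.of_apply]
    rw [← Finset.sum_range fun l => c i l • x l]
    refine Finset.sum_subset (Finset.range_subset_range.2 i.2) fun l _ hl => ?_
    rw [hc0 i l (by simpa using hl), zero_smul]
  rw [h, alternatingMap_apply_matrix _ _ fun l : Fin (a j) => x l,
    Matrix.det_of_isLowerTriangular]
  · simp [hc1]
  · intro i l hil
    exact hc0 i l hil

/-- If the pairing is lower triangular, contraction removes the first vectors up to a scalar. -/
theorem exists_skewContraction_eq_smul {h k : ℕ} (hk : h ≤ k) (α : ℕ → Module.Dual K V)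
    (x : ℕ → V) (hα : ∀ i j, i < h → i < j → α i (x j) = 0) :
    ∃ r : K, skewContraction K V hk (exteriorPower.ιMulti K h fun i => α i)
      (exteriorPower.ιMulti K k fun i => x i) =
        r • exteriorPower.ιMulti K (k - h) fun i => x (h + i) := by
  suffices H : skewContraction K V hk (exteriorPower.ιMulti K h fun i => α i)
      (exteriorPower.ιMulti K k fun i => x i) ∈
      Submodule.span K {exteriorPower.ιMulti K (k - h) fun i => x (h + i)} by
    obtain ⟨r, hr⟩ := Submodule.mem_span_singleton.1 H
    exact ⟨r, hr.symm⟩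
  rw [skewContraction_ιMulti]
  refine Submodule.sum_mem _ fun R _ => Submodule.smul_mem _ _ ?_
  -- Either `R` consists of the first `h` indices, by cardinality, or it contains an index `≥ h`,
  -- whose column in the determinant is zero.
  by_cases hR : ∀ y ∈ R.1, (y : ℕ) < h
  · refine Submodule.smul_mem _ _ ?_
    have hRs : ∀ y : Fin k, y ∈ R.1 ↔ (y : ℕ) < h := by
      have : R.1 = Finset.univ.filter fun y : Fin k => (y : ℕ) < h := by
        refine Finset.eq_of_subset_of_card_le (fun y hy => by simpa using hR y hy) ?_
        rw [R.2, Fin.card_filter_val_lt]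
        exact min_le_right _ _
      intro y
      rw [this]
      simp
    have hinr : ∀ i : Fin (k - h), (splitEquiv R (Sum.inr i) : ℕ) = h + i := by
      intro i
      have := congrFun (Finset.orderEmbOfFin_unique
        (s := R.1ᶜ) (k := k - h) (by rw [Finset.card_compl, R.2, Fintype.card_fin])
        (f := fun i => ⟨h + i, by omega⟩) (by intro x; simp [hRs])
        (by intro x y hxy; simpa using hxy)) i
      simp [splitEquiv, ← this]
    simp only [hinr]
    exact Submodule.mem_span_singleton_self _
  · push Not at hR
    obtain ⟨y, hy, hyh⟩ := hR
    obtain ⟨j, hj⟩ : ∃ j, R.1.orderEmbOfFin R.2 j = y := by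
      have : y ∈ Set.range (R.1.orderEmbOfFin R.2) := by simpa using hy
      exact this
    rw [Matrix.det_eq_zero_of_column_eq_zero j, zero_smul]
    · exact Submodule.zero_mem _
    · intro i
      simp only [Matrix.of_apply, splitEquiv, finSumEquivOfFinset_inl, hj]
      exact hα i y i.2 (i.2.trans_le hyh)

/-- Column `j` retains the vectors of `x` from index `mu.colLen j` on. These are the rows of the
skew diagram, so one family `x` serves all columns. -/
theorem extApolarity_flagTensor_mem_of_triangular [CharZero K] (m : ℕ) {lam mu : YoungDiagram}
    (hmu : mu ≤ lam) (x : ℕ → V) (α : ℕ → Module.Dual K V)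
    (hα : ∀ i j, i < mu.colLen 0 → i < j → α i (x j) = 0) :
    extApolarity K V m hmu (flagTensor K V (colLens m lam) 0 x)
      (flagTensor K (Module.Dual K V) (colLens m mu) 0 α) ∈ skewSchurModule K V m lam mu := by
  -- Column lengths decrease weakly, so the vanishing for `i < mu.colLen 0` covers every column.
  have h := fun j : Fin m => exists_skewContraction_eq_smul (colLens_mono m hmu j) α x
    fun i l hi => hα i l (hi.trans_le (mu.colLen_anti 0 j (Nat.zero_le _)))
  choose r hr using h
  have : extApolarity K V m hmu (flagTensor K V (colLens m lam) 0 x)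
      (flagTensor K (Module.Dual K V) (colLens m mu) 0 α) =
      (∏ j, r j) • flagTensor K V (skewColLens m lam mu) (colLens m mu) x := by
    simp only [flagTensor, wedgeTensor_apply, Box.row, Pi.zero_apply, zero_add]
    refine (PiTensorProduct.map₂_tprod_tprod _ _ _).trans ?_
    rw [← MultilinearMap.map_smul_univ]
    exact congrArg _ (funext hr)
  rw [this]
  exact Submodule.smul_mem _ _ (flagTensor_mem_schurOfShape K V _ _ x)

theorem extApolarity_flagTensor_mem_of_det_ne_zero [CharZero K] (m : ℕ) {lam mu : YoungDiagram}
    (hmu : mu ≤ lam) (x : ℕ → V) (α : ℕ → Module.Dual K V)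
    (h : ∀ k ≤ mu.colLen 0, (Matrix.of fun i l : Fin k => α i (x l)).det ≠ 0) :
    extApolarity K V m hmu (flagTensor K V (colLens m lam) 0 x)
      (flagTensor K (Module.Dual K V) (colLens m mu) 0 α) ∈ skewSchurModule K V m lam mu := by
  obtain ⟨c, hc1, hc0, hc⟩ := exists_unitriangular α x _ h
  rw [← flagTensor_unitriangular _ x c hc1 hc0]
  exact extApolarity_flagTensor_mem_of_triangular m hmu _ α hc

/-- The `m + 1` guarantees that column 0 is a tensor factor: dependence of its vectors must make the
whole tensor vanish. -/
theorem extApolarity_flagTensor_mem [CharZero K] (m : ℕ) {lam mu : YoungDiagram}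
    (hmu : mu ≤ lam) (x : ℕ → V) (α : ℕ → Module.Dual K V) :
    extApolarity K V (m + 1) hmu (flagTensor K V (colLens (m + 1) lam) 0 x)
      (flagTensor K (Module.Dual K V) (colLens (m + 1) mu) 0 α) ∈
      skewSchurModule K V (m + 1) lam mu := by
  by_cases hx : LinearIndependent K fun i : Fin (lam.colLen 0) => x i
  · obtain ⟨β, s, hs, hβ⟩ := exists_translate_det_ne_zero α x _ hx
    -- With `x` fixed, the contraction is multilinear in the boxes of `mu`, so only the functionals
    -- are moved.
    exact map_mem_of_map_add_smul_mem (N := ExtTensor K V (skewColLens (m + 1) lam mu))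
      ((extApolarity K V (m + 1) hmu
        (flagTensor K V (colLens (m + 1) lam) 0 x)).compMultilinearMap
        (wedgeTensor K (Module.Dual K V) (colLens (m + 1) mu)))
      (skewSchurModule K V (m + 1) lam mu)
      (fun y => α (Box.row 0 y)) (fun y => β (Box.row 0 y)) hs fun t ht =>
        extApolarity_flagTensor_mem_of_det_ne_zero (m + 1) hmu x (fun i => α i + t • β i)
          fun k hk => hβ t ht k (hk.trans (colLens_mono 1 hmu 0))
  · have h0 : flagTensor K V (colLens (m + 1) lam) 0 x = 0 := by
      rw [flagTensor, wedgeTensor_apply]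
      refine MultilinearMap.map_coord_zero _ 0 ?_
      refine AlternatingMap.map_linearDependent _ _ ?_
      simp only [Box.row, Pi.zero_apply, zero_add]
      exact hx
    rw [h0]
    simp

end Contraction

/-! ### Reduction to flag tensors and conclusion -/

theorem range_schurApolarity_le (K : Type*) [Field K] [CharZero K] (V : Type*) [AddCommGroup V]
    [Module K V] (m : ℕ) {lam mu : YoungDiagram} (hmu : mu ≤ lam)
    (H : ∀ (x : ℕ → V) (α : ℕ → Module.Dual K V),
      extApolarity K V m hmu (flagTensor K V (colLens m lam) 0 x)
        (flagTensor K (Module.Dual K V) (colLens m mu) 0 α) ∈ skewSchurModule K V m lam mu) :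
    LinearMap.range (schurApolarity K V m hmu) ≤ skewSchurModule K V m lam mu := by
  have hle : Submodule.map₂ (extApolarity K V m hmu) (schurModule K V m lam)
      (schurModule K (Module.Dual K V) m mu) ≤ skewSchurModule K V m lam mu := by
    refine (Submodule.map₂_le_map₂ (schurOfShape_le_span K V _ _)
      (schurOfShape_le_span K (Module.Dual K V) _ _)).trans ?_
    rw [Submodule.map₂_span_span, Submodule.span_le]
    rintro _ ⟨_, ⟨x, rfl⟩, _, ⟨α, rfl⟩, rfl⟩
    exact H x α
  rintro _ ⟨z, rfl⟩
  induction z with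
  | zero => rw [map_zero]; exact Submodule.zero_mem _
  | tmul u w => exact hle (Submodule.apply_mem_map₂ _ u.2 w.2)
  | add u w hu hw => rw [map_add]; exact Submodule.add_mem _ hu hw

end SchurApolarity

end

theorem mainTheorem4 {K : Type*} [Field K] [IsAlgClosed K] [CharZero K]
    {V : Type*} [AddCommGroup V] [Module K V] [FiniteDimensional K V]
    (lam mu : YoungDiagram) (hmu : mu ≤ lam) :
    LinearMap.range (SchurApolarity.schurApolarity K V (lam.rowLen 0) hmu) ≤
      SchurApolarity.skewSchurModule K V (lam.rowLen 0) lam mu := by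
  refine SchurApolarity.range_schurApolarity_le K V _ hmu fun x α => ?_
  rcases Nat.eq_zero_or_pos (lam.rowLen 0) with h0 | h0
  -- For empty `lam` there is no column 0 among the factors, but `mu` is empty too and triangularity
  -- is vacuous.
  · have hlam : lam.colLen 0 = 0 := by
      by_contra h
      have h1 := YoungDiagram.mem_iff_lt_colLen.2 (Nat.pos_of_ne_zero h)
      exact h0.not_gt (YoungDiagram.mem_iff_lt_rowLen.1 h1)
    have hmu0 : mu.colLen 0 ≤ lam.colLen 0 := SchurApolarity.colLens_mono 1 hmu 0
    exact SchurApolarity.extApolarity_flagTensor_mem_of_triangular _ hmu x α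
      fun i j hi => absurd hi (by omega)
  · obtain ⟨m, hm⟩ := Nat.exists_eq_succ_of_ne_zero h0.ne'
    rw [hm]
    exact SchurApolarity.extApolarity_flagTensor_mem m hmu x α
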